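/- Let $\mathfrak g$ be a finite-dimensional perfect Lie algebra over $\mathbb C$ with radical $\mathfrak h=\operatorname{Rad}(\mathfrak g)$ and a simple Levi subalgebra $\mathfrak g_L$, so that $\mathfrak g=\mathfrak g_L\ltimes\mathfrak h$. Let $\mathfrak h=V_n\oplus V_m\oplus V_p\oplus V_k$ be a decomposition into simple $\mathfrak g_L$-submodules such that $Z(\mathfrak h)=V_k$. For subspaces $U,W$ let $[U,W]$ be the span of all brackets $[u,w]$, $u\in U$, $w\in W$, and assume that for all $i,j\in\{n,m,p,k\}$ the subspace $[V_i,V_j]$ is either $0$ or equal to one of $V_n,V_m,V_p,V_k$. Then, after a permutation of the names $V_n,V_m,V_p$, one of the following holds (an entry $A/B$ of a table means that the bracket equals one of the listed subspaces): 1. $[\mathfrak h,\mathfrak h]=Z(\mathfrak h)$; 2. $[\mathfrak h,\mathfrak h]=V_m\oplus V_p\oplus V_k$ and the multiplication table of $\mathfrak h$ is $$\begin{array}{|c|c|c|c|c|}\hline [\,,] & V_n & V_m & V_p & V_k\\ \hline V_n & V_m & V_p & V_k & 0\\ \hline V_m & V_p & V_k/0 & 0 & 0\\ \hline V_p & V_k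 & 0 & 0 & 0\\ \hline V_k & 0&0&0&0\\ \hline\end{array}$$ 3. $[\mathfrak h,\mathfrak h]=V_p\oplus V_k$ and the multiplication table of $\mathfrak h$ is one of $$\begin{array}{|c|c|c|c|c|}\hline [\,,] & V_n & V_m & V_p & V_k\\ \hline V_n & V_p/V_k/0 & V_p & V_k & 0\\ \hline V_m & V_p & V_p/V_k/0 & V_k & 0\\ \hline V_p & V_k & V_k & 0 & 0\\ \hline V_k & 0&0&0&0\\ \hline\end{array}\qquad \begin{array}{|c|c|c|c|c|}\hline [\,,] & V_n & V_m & V_p & V_k\\ \hline V_n & V_p/V_k/0 & V_p & V_k & 0\\ \hline V_m & V_p & V_k/0 & 0 & 0\\ \hline V_p & V_k & 0 & 0 & 0\\ \hline V_k & 0&0&0&0\\ \hline\end{array}$$ $$\begin{array}{|c|c|c|c|c|}\hline [\,,] & V_n & V_m & V_p & V_k\\ \hline V_n & V_p & 0 & V_k & 0\\ \hline V_m & 0 & V_k & 0 & 0\\ \hline V_p & V_k & 0 & 0 & 0\\ \hline V_k & 0&0&0&0\\ \hline\end{array}\qquad \begin{array}{|c|c|c|c|c|}\hline [\,,] & V_n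 & V_m & V_p & V_k\\ \hline V_n & V_p & V_k & V_k & 0\\ \hline V_m & V_k & V_k/0 & 0 & 0\\ \hline V_p & V_k & 0 & 0 & 0\\ \hline V_k & 0&0&0&0\\ \hline\end{array}$$ Moreover, if $[\mathfrak h,\mathfrak h]=V_m\oplus V_p\oplus V_k$ with the given names, then the table in 2 holds, possibly after exchanging the names $V_m$ and $V_p$; and if $[\mathfrak h,\mathfrak h]=V_p\oplus V_k$ with the given names, then one of the tables in 3 holds, possibly after exchanging the names $V_n$ and $V_m$. -/

import Mathlib

/-- For subspaces `U`, `W` of a Lie algebra, the subspace `[U, W]` spanned by all brackets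
`[u, w]` with `u ∈ U` and `w ∈ W`. -/
def bracketSpan {g : Type*} [LieRing g] [LieAlgebra ℂ g] (U W : Submodule ℂ g) :
    Submodule ℂ g :=
  Submodule.span ℂ {z | ∃ u ∈ U, ∃ w ∈ W, ⁅u, w⁆ = z}

/-- The centre `Z(h)` of an ideal `h` (as a Lie algebra in its own right), viewed as a subspace
of the ambient Lie algebra. -/
def centerOfIdeal {g : Type*} [LieRing g] [LieAlgebra ℂ g] (h : LieIdeal ℂ g) :
    Submodule ℂ g :=
  (LieAlgebra.center ℂ h).toSubmodule.map h.toSubmodule.subtype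

/-- The derived algebra `[h, h]` of an ideal `h`, as a subspace of the ambient Lie algebra. -/
def derivedOfIdeal {g : Type*} [LieRing g] [LieAlgebra ℂ g] (h : LieIdeal ℂ g) :
    Submodule ℂ g :=
  ⁅h, h⁆.toSubmodule

/-- A Lie algebra is perfect if it equals its derived algebra. -/
def IsPerfectLie (g : Type*) [LieRing g] [LieAlgebra ℂ g] : Prop :=
  ⁅(⊤ : LieIdeal ℂ g), (⊤ : LieIdeal ℂ g)⁆ = ⊤

/-- `gL` is a simple Levi subalgebra: a simple subalgebra which is a vector space complement of
the radical, so that `g = gL ⋉ Rad(g)`. -/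
structure IsSimpleLevi {g : Type*} [LieRing g] [LieAlgebra ℂ g] (gL : LieSubalgebra ℂ g) :
    Prop where
  isSimple : LieAlgebra.IsSimple ℂ gL
  isCompl : IsCompl gL.toSubmodule (LieAlgebra.radical ℂ g).toSubmodule

/-- The radical of `g` is the internal direct sum of the simple `gL`-modules `V 0`, `V 1`, `V 2`,
`V 3` (also written `V_n`, `V_m`, `V_p`, `V_k`). -/
structure IsSimpleDecomposition {g : Type*} [LieRing g] [LieAlgebra ℂ g]
    (gL : LieSubalgebra ℂ g) (V : Fin 4 → LieSubmodule ℂ gL g) : Prop where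
  isIrreducible : ∀ i, LieModule.IsIrreducible ℂ gL (V i)
  independent : iSupIndep fun i => (V i).toSubmodule
  iSup_eq : ⨆ i, (V i).toSubmodule = (LieAlgebra.radical ℂ g).toSubmodule

/-- A multiplication table for four subspaces. An entry is the set of subspaces that
are allowed as the value of the corresponding bracket. -/
abbrev MulTable (g : Type*) [LieRing g] [LieAlgebra ℂ g] :=
  Matrix (Fin 4) (Fin 4) (Set (Submodule ℂ g))

/-- The brackets `[V i, V j]` are as prescribed by the table `T`, which is
written in terms of `V 0`, `V 1`, `V 2`, `V 3`. -/
def HasTable {g : Type*} [LieRing g] [LieAlgebra ℂ g] {gL : LieSubalgebra ℂ g}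
    (V : Fin 4 → LieSubmodule ℂ gL g)
    (T : Submodule ℂ g → Submodule ℂ g → Submodule ℂ g → Submodule ℂ g → MulTable g) : Prop :=
  ∀ i j, bracketSpan (V i).toSubmodule (V j).toSubmodule ∈
    T (V 0).toSubmodule (V 1).toSubmodule (V 2).toSubmodule (V 3).toSubmodule i j

section Tables

set_option linter.unusedVariables false

variable {g : Type*} [LieRing g] [LieAlgebra ℂ g]

/-- The table for `[h, h] = V_m ⊕ V_p ⊕ V_k`. -/
def tableMPK (Vn Vm Vp Vk : Submodule ℂ g) : MulTable g :=
  !![{Vm}, {Vp},    {Vk}, {⊥};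
     {Vp}, {Vk, ⊥}, {⊥},  {⊥};
     {Vk}, {⊥},     {⊥},  {⊥};
     {⊥},  {⊥},     {⊥},  {⊥}]

/-- The first table for `[h, h] = V_p ⊕ V_k`. -/
def tablePK₁ (Vn Vm Vp Vk : Submodule ℂ g) : MulTable g :=
  !![{Vp, Vk, ⊥}, {Vp},        {Vk}, {⊥};
     {Vp},        {Vp, Vk, ⊥}, {Vk}, {⊥};
     {Vk},        {Vk},        {⊥},  {⊥};
     {⊥},         {⊥},         {⊥},  {⊥}]

/-- The second table for `[h, h] = V_p ⊕ V_k`. -/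
def tablePK₂ (Vn Vm Vp Vk : Submodule ℂ g) : MulTable g :=
  !![{Vp, Vk, ⊥}, {Vp},    {Vk}, {⊥};
     {Vp},        {Vk, ⊥}, {⊥},  {⊥};
     {Vk},        {⊥},     {⊥},  {⊥};
     {⊥},         {⊥},     {⊥},  {⊥}]

/-- The third table for `[h, h] = V_p ⊕ V_k`. -/
def tablePK₃ (Vn Vm Vp Vk : Submodule ℂ g) : MulTable g :=
  !![{Vp}, {⊥},  {Vk}, {⊥};
     {⊥},  {Vk}, {⊥},  {⊥};
     {Vk}, {⊥},  {⊥},  {⊥};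
     {⊥},  {⊥},  {⊥},  {⊥}]

/-- The fourth table for `[h, h] = V_p ⊕ V_k`. -/
def tablePK₄ (Vn Vm Vp Vk : Submodule ℂ g) : MulTable g :=
  !![{Vp}, {Vk},    {Vk}, {⊥};
     {Vk}, {Vk, ⊥}, {⊥},  {⊥};
     {Vk}, {⊥},     {⊥},  {⊥};
     {⊥},  {⊥},     {⊥},  {⊥}]

/-- One of the four tables for `[h, h] = V_p ⊕ V_k` holds. -/
def HasTablePK {gL : LieSubalgebra ℂ g} (V : Fin 4 → LieSubmodule ℂ gL g) : Prop :=
  HasTable V tablePK₁ ∨ HasTable V tablePK₂ ∨ HasTable V tablePK₃ ∨ HasTable V tablePK₄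

end Tables

/-! ### Action of the radical of a perfect Lie algebra -/

section PerfectLie

open LieAlgebra LieModule Module

/-! Lie's theorem makes the radical act on an irreducible module by a character. Perfectness forces
all traces to vanish, so the character is zero. Applied to the quotient of a nonzero ideal `N` by a
maximal subideal, this shows that the bracket of the radical with `N` is smaller than `N`
(`eq_bot_of_le_radical_lie`).

Since brackets of summands are summands or zero, they form a table on the indices `n`, `m`, `p`,
`k`, `zero`. The table is symmetric and zero on `k`, and it satisfies three conditions. No
composition of row maps fixes a nonzero summand, by the shrinking above. The rows `n`, `m`, `p` are
nonzero, since the centre is only `V_k`. Finally, the Jacobi identity puts a nonzero summand inside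
a sum of two summands, so by independence it is one of them (`val_le_sup`).

The rest is a finite check, `all_tableCheck`. Acyclicity with nonzero rows makes every chain of
brackets end in `k`, so `k` occurs. The indices `n`, `m`, `p` cannot all occur, as each would then
have a predecessor and a cycle would arise. The number of those that occur, zero, one or two,
separates the three cases. -/

/-- The radical of a perfect Lie algebra acts trivially on irreducible modules. -/
theorem radical_lie_eq_zero_of_isIrreducible {g : Type*} [LieRing g] [LieAlgebra ℂ g]
    [FiniteDimensional ℂ g] (hperf : IsPerfectLie g) {M : Type*} [AddCommGroup M] [Module ℂ M]
    [LieRingModule g M] [LieModule ℂ g M] [FiniteDimensional ℂ M] [IsIrreducible ℂ g M]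
    {x : g} (hx : x ∈ radical ℂ g) (m : M) : ⁅x, m⁆ = 0 := by
  have _i := nontrivial_of_isIrreducible ℂ g M
  obtain ⟨χ, hχ⟩ : ∃ χ : Module.Dual ℂ (radical ℂ g), Nontrivial (weightSpace M χ) :=
    exists_nontrivial_weightSpace_of_isSolvable ℂ (radical ℂ g) M
  -- Weight spaces of an ideal are stable under all of `g` in characteristic zero, so irreducibility
  -- makes this one everything.
  let N : LieSubmodule ℂ g M := weightSpaceOfIsLieTower ℂ M χ
  replace hχ : Nontrivial N := hχ
  replace hχ : N = ⊤ := N.eq_top_of_isIrreducible ℂ g M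
  have hm (m : M) : ⁅x, m⁆ = χ ⟨x, hx⟩ • m := by
    have : ∀ (y : g) (hy : y ∈ radical ℂ g), ⁅y, m⁆ = χ ⟨y, hy⟩ • m := by
      simpa [N, weightSpaceOfIsLieTower, mem_weightSpace] using
        (hχ ▸ LieSubmodule.mem_top _ : m ∈ N)
    exact this x hx
  have htr : LinearMap.trace ℂ M (toEnd ℂ g M x) = 0 := by
    -- The trace vanishes on commutators and is linear; facts about the fixed `x` are dropped so
    -- that the span induction can vary it.
    clear hm hx
    have hx' : x ∈ (⁅(⊤ : LieIdeal ℂ g), (⊤ : LieIdeal ℂ g)⁆ : LieIdeal ℂ g).toSubmodule := by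
      rw [show ⁅(⊤ : LieIdeal ℂ g), (⊤ : LieIdeal ℂ g)⁆ = ⊤ from hperf]; trivial
    rw [LieSubmodule.lieIdeal_oper_eq_linear_span'] at hx'
    induction hx' using Submodule.span_induction with
    | mem y hy => obtain ⟨a, -, b, -, rfl⟩ := hy; simp
    | zero => simp
    | add y z _ _ hy hz => simp [hy, hz]
    | smul t y _ hy => simp [hy]
  have hid : toEnd ℂ g M x = χ ⟨x, hx⟩ • LinearMap.id := by ext m; simp [hm]
  have hfr : finrank ℂ M ≠ 0 := finrank_pos.ne'
  rw [hid, map_smul, LinearMap.trace_id, smul_eq_mul, mul_eq_zero] at htr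
  rw [hm, htr.resolve_right (by exact_mod_cast hfr), zero_smul]

/-- The bracket with the radical of a perfect Lie algebra shrinks every nonzero ideal. -/
theorem eq_bot_of_le_radical_lie {g : Type*} [LieRing g] [LieAlgebra ℂ g]
    [FiniteDimensional ℂ g] (hperf : IsPerfectLie g) (N : LieIdeal ℂ g)
    (hN : N ≤ ⁅radical ℂ g, N⁆) : N = ⊥ := by
  by_contra hne
  have : Nontrivial N := (LieSubmodule.nontrivial_iff_ne_bot ℂ g g).mpr hne
  obtain ⟨K, hK⟩ : ∃ K : LieSubmodule ℂ g N, IsCoatom K :=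
    (eq_top_or_exists_le_coatom (⊥ : LieSubmodule ℂ g N)).resolve_left
      bot_ne_top |>.imp fun _ h => h.1
  have : IsIrreducible ℂ g (N ⧸ K) := by
    have : Nontrivial (N ⧸ K) := Submodule.Quotient.nontrivial_iff.mpr fun h =>
      hK.1 (LieSubmodule.toSubmodule_injective h)
    refine IsIrreducible.mk fun P hP => ?_
    have hlt : K < P.comap (LieSubmodule.Quotient.mk' K) := by
      refine lt_of_le_of_ne (fun k hk => ?_) fun h => hP ?_
      · rw [LieSubmodule.mem_comap, LieSubmodule.Quotient.mk'_apply,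
          LieSubmodule.Quotient.mk_eq_zero'.mpr hk]
        exact P.zero_mem
      · rw [eq_bot_iff]
        intro y hy
        obtain ⟨n, rfl⟩ := LieSubmodule.Quotient.surjective_mk' K y
        have : n ∈ K := h ▸ hy
        rwa [LieSubmodule.mem_bot, LieSubmodule.Quotient.mk'_apply,
          LieSubmodule.Quotient.mk_eq_zero']
    rw [eq_top_iff]
    intro y _
    obtain ⟨n, rfl⟩ := LieSubmodule.Quotient.surjective_mk' K y
    exact (hK.2 _ hlt ▸ LieSubmodule.mem_top n :)
  apply hK.1
  rw [eq_top_iff]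
  -- The radical kills the irreducible quotient `N ⧸ K`, so its bracket with `N` lands in `K`.
  have key : N ≤ K.map (LieSubmodule.incl N) := by
    refine hN.trans ?_
    rw [LieSubmodule.lieIdeal_oper_eq_span, LieSubmodule.lieSpan_le]
    rintro _ ⟨x, n, rfl⟩
    refine ⟨⁅(x : g), n⁆, ?_, rfl⟩
    have := radical_lie_eq_zero_of_isIrreducible hperf x.2 (LieSubmodule.Quotient.mk n : N ⧸ K)
    exact LieSubmodule.Quotient.mk_eq_zero'.mp this
  rintro ⟨n, hn⟩ -
  obtain ⟨k, hk, hkn⟩ := key hn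
  have : k = ⟨n, hn⟩ := Subtype.ext hkn
  exact this ▸ hk

/-- A summand is only a `gL`-submodule, so the shrinking of ideals is applied to the ideal it
generates. -/
theorem eq_bot_of_le_radical_lie_lieSpan {g : Type*} [LieRing g] [LieAlgebra ℂ g]
    [FiniteDimensional ℂ g] (hperf : IsPerfectLie g) (W : Submodule ℂ g)
    (hW : W ≤ (⁅radical ℂ g, LieSubmodule.lieSpan ℂ g (W : Set g)⁆ : LieIdeal ℂ g).toSubmodule) :
    W = ⊥ := by
  have h := eq_bot_of_le_radical_lie hperf _ (LieSubmodule.lieSpan_le.mpr hW)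
  rw [eq_bot_iff]
  intro x hx
  have := LieSubmodule.subset_lieSpan (R := ℂ) (L := g) hx
  rw [h] at this
  exact this

end PerfectLie

/-! ### Calculus of brackets of subspaces -/

section Brackets

variable {g : Type*} [LieRing g] [LieAlgebra ℂ g]

/-- Gives access to the compatibility of `Submodule.map₂` with suprema and `⊥`. -/
theorem bracketSpan_eq_map₂ (U W : Submodule ℂ g) :
    bracketSpan U W = Submodule.map₂ (LieModule.toEnd ℂ g g : g →ₗ[ℂ] Module.End ℂ g) U W := by
  rw [Submodule.map₂_eq_span_image2]
  rfl

theorem bracketSpan_le {U W X : Submodule ℂ g} :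
    bracketSpan U W ≤ X ↔ ∀ u ∈ U, ∀ w ∈ W, ⁅u, w⁆ ∈ X := by
  rw [bracketSpan_eq_map₂, Submodule.map₂_le]
  rfl

theorem lie_mem_bracketSpan {U W : Submodule ℂ g} {u w : g} (hu : u ∈ U) (hw : w ∈ W) :
    ⁅u, w⁆ ∈ bracketSpan U W :=
  bracketSpan_le.mp le_rfl u hu w hw

theorem bracketSpan_comm (U W : Submodule ℂ g) : bracketSpan U W = bracketSpan W U := by
  refine le_antisymm ?_ ?_ <;>
  · refine bracketSpan_le.mpr fun u hu w hw => ?_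
    rw [← lie_skew]
    exact neg_mem (lie_mem_bracketSpan hw hu)

theorem bracketSpan_bot (U : Submodule ℂ g) : bracketSpan U ⊥ = ⊥ := by
  rw [bracketSpan_eq_map₂, Submodule.map₂_bot_right]

theorem bracketSpan_jacobi (U W X : Submodule ℂ g) :
    bracketSpan U (bracketSpan W X) ≤
      bracketSpan (bracketSpan U W) X ⊔ bracketSpan W (bracketSpan U X) := by
  refine bracketSpan_le.mpr fun u hu y hy => ?_
  induction hy using Submodule.span_induction with
  | mem y hy =>
    obtain ⟨w, hw, x, hx, rfl⟩ := hy
    rw [leibniz_lie]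
    exact Submodule.add_mem_sup (lie_mem_bracketSpan (lie_mem_bracketSpan hu hw) hx)
      (lie_mem_bracketSpan hw (lie_mem_bracketSpan hu hx))
  | zero => simp
  | add y z _ _ hy hz => rw [lie_add]; exact add_mem hy hz
  | smul t y _ hy => rw [lie_smul]; exact Submodule.smul_mem _ _ hy

theorem bracketSpan_le_lie (h N : LieIdeal ℂ g) {U W : Submodule ℂ g}
    (hU : U ≤ h.toSubmodule) (hW : W ≤ N.toSubmodule) :
    bracketSpan U W ≤ (⁅h, N⁆ : LieIdeal ℂ g).toSubmodule :=
  bracketSpan_le.mpr fun _ hu _ hw => LieSubmodule.lie_mem_lie (hU hu) (hW hw)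

theorem derivedOfIdeal_eq_bracketSpan (h : LieIdeal ℂ g) :
    derivedOfIdeal h = bracketSpan h.toSubmodule h.toSubmodule := by
  rw [derivedOfIdeal, LieSubmodule.lieIdeal_oper_eq_linear_span']
  rfl

end Brackets

/-! ### Finite combinatorics of multiplication tables -/

/-- The index set of the subspaces `V_n`, `V_m`, `V_p`, `V_k` and `0`. -/
inductive Slot
  | n | m | p | k | zero

namespace Slot

/-- Equality of indices, as a Boolean. -/
def beq : Slot → Slot → Bool
  | n, n | m, m | p, p | k, k | zero, zero => true
  | _, _ => false

theorem beq_iff (x y : Slot) : beq x y = true ↔ x = y := by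
  cases x <;> cases y <;> simp [beq]

theorem beq_eq_false_iff (x y : Slot) : beq x y = false ↔ x ≠ y := by
  cases x <;> cases y <;> simp [beq]

/-- Implication of Booleans. -/
def imp : Bool → Bool → Bool
  | false, _ => true
  | true, b => b

theorem imp_iff (a b : Bool) : imp a b = true ↔ (a = true → b = true) := by
  cases a <;> simp [imp]

/-- Universal quantification, as a Boolean. -/
def all (q : Slot → Bool) : Bool := q n && (q m && (q p && (q k && q zero)))

theorem all_iff (q : Slot → Bool) : all q = true ↔ ∀ x, q x = true := by
  simp only [all, Bool.and_eq_true]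
  exact ⟨fun h x => by cases x <;> tauto, fun h => ⟨h _, h _, h _, h _, h _⟩⟩

/-- Universal quantification over the indices `n`, `m`, `p`, as a Boolean. -/
def all₃ (q : Slot → Bool) : Bool := q n && (q m && q p)

theorem all₃_of_forall {q : Slot → Bool} (h : ∀ x, x ≠ k → x ≠ zero → q x = true) :
    all₃ q = true := by
  simp only [all₃, h n nofun nofun, h m nofun nofun, h p nofun nofun, Bool.and_self]

/-- Existential quantification over the indices `n`, `m`, `p`, as a Boolean. -/
def ex₃ (q : Slot → Bool) : Bool := q n || (q m || q p)

theorem ex₃_of_exists {q : Slot → Bool} (h : ∃ x, q x = true) (hk : q k = false)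
    (hz : q zero = false) : ex₃ q = true := by
  obtain ⟨x, hx⟩ := h
  cases x <;> simp_all [ex₃]

theorem exists_of_ex₃ {q : Slot → Bool} (h : ex₃ q = true) : ∃ x, q x = true := by
  simp only [ex₃, Bool.or_eq_true] at h
  rcases h with h | h | h <;> exact ⟨_, h⟩

/-- The symmetric multiplication table with the entries `a, …, f` for `n, m, p`, which is zero
elsewhere. -/
def symmTable (a b c d e f : Slot) : Slot → Slot → Slot
  | n => fun | n => a | m => b | p => c | _ => zero
  | m => fun | n => b | m => d | p => e | _ => zero
  | p => fun | n => c | m => e | p => f | _ => zero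
  | _ => fun _ => zero

theorem symmTable_comm (a b c d e f i j : Slot) :
    symmTable a b c d e f i j = symmTable a b c d e f j i := by
  cases i <;> cases j <;> rfl

theorem symmTable_k (a b c d e f i : Slot) : symmTable a b c d e f i k = zero := by
  cases i <;> rfl

theorem symmTable_zero (a b c d e f i : Slot) : symmTable a b c d e f i zero = zero := by
  cases i <;> rfl

/-- The rows `n`, `m`, `p` of the table are nonzero. -/
def rowsCheck (T : Slot → Slot → Slot) : Bool :=
  all₃ fun i => ex₃ fun j => !beq (T i j) zero

/-- No composition of at most three row maps `T i` fixes an index. -/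
def acyclicCheck (T : Slot → Slot → Slot) : Bool :=
  all₃ fun l => all₃ fun i => !beq (T i l) l && all₃ fun j => !beq (T j (T i l)) l &&
    all₃ fun h => !beq (T h (T j (T i l))) l

/-- The restriction on the table imposed by the Jacobi identity. -/
def jacobiCheck (T : Slot → Slot → Slot) : Bool :=
  all₃ fun i => all₃ fun j => all₃ fun l => beq (T i (T j l)) zero ||
    (beq (T i (T j l)) (T (T i j) l) || beq (T i (T j l)) (T j (T i l)))

/-- The index `l` occurs in the table. -/
def occurs (T : Slot → Slot → Slot) (l : Slot) : Bool :=
  ex₃ fun i => ex₃ fun j => beq (T i j) l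

/-- The table `T` satisfies the conditions of `tableMPK`, for the given names. -/
def fitsMPK (T : Slot → Slot → Slot) (i j l : Slot) : Bool :=
  beq (T i i) j && (beq (T i j) l && (beq (T i l) k && ((beq (T j j) k || beq (T j j) zero) &&
    (beq (T j l) zero && beq (T l l) zero))))

/-- Only entries on or above the diagonal of the block of `i`, `j`, `l` are tested; symmetry and the
zero row of `k` supply the others. -/
def fitsPK₁ (T : Slot → Slot → Slot) (i j l : Slot) : Bool :=
  (beq (T i i) l || (beq (T i i) k || beq (T i i) zero)) && (beq (T i j) l && (beq (T i l) k &&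
    ((beq (T j j) l || (beq (T j j) k || beq (T j j) zero)) && (beq (T j l) k &&
      beq (T l l) zero))))

def fitsPK₂ (T : Slot → Slot → Slot) (i j l : Slot) : Bool :=
  (beq (T i i) l || (beq (T i i) k || beq (T i i) zero)) && (beq (T i j) l && (beq (T i l) k &&
    ((beq (T j j) k || beq (T j j) zero) && (beq (T j l) zero && beq (T l l) zero))))

def fitsPK₃ (T : Slot → Slot → Slot) (i j l : Slot) : Bool :=
  beq (T i i) l && (beq (T i j) zero && (beq (T i l) k && (beq (T j j) k &&
    (beq (T j l) zero && beq (T l l) zero))))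

def fitsPK₄ (T : Slot → Slot → Slot) (i j l : Slot) : Bool :=
  beq (T i i) l && (beq (T i j) k && (beq (T i l) k && ((beq (T j j) k || beq (T j j) zero) &&
    (beq (T j l) zero && beq (T l l) zero))))

def fitsPK (T : Slot → Slot → Slot) (i j l : Slot) : Bool :=
  fitsPK₁ T i j l || (fitsPK₂ T i j l || (fitsPK₃ T i j l || fitsPK₄ T i j l))

/-- The possible sets of occurring indices, and the tables for two of them. -/
def conclusionCheck (T : Slot → Slot → Slot) : Bool :=
  (occurs T k && !(occurs T n && (occurs T m && occurs T p))) &&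
    (imp (!occurs T n && (occurs T m && occurs T p)) (fitsMPK T n m p || fitsMPK T n p m) &&
      imp (!occurs T n && (!occurs T m && occurs T p)) (fitsPK T n m p || fitsPK T m n p))

/-- The table passes the conclusion check if it passes the others. -/
def tableCheck (T : Slot → Slot → Slot) : Bool :=
  imp (acyclicCheck T) <| imp (rowsCheck T) <| imp (jacobiCheck T) <| conclusionCheck T

/-- Exhaustion by kernel evaluation. The guards are the length-one part of acyclicity and sit
directly after each quantifier, so that excluded branches are cut early. -/
theorem all_tableCheck :
    (all fun a => imp (!beq a n) <| all fun d => imp (!beq d m) <| all fun f => imp (!beq f p) <|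
      all fun b => imp (!beq b n && !beq b m) <| all fun c => imp (!beq c n && !beq c p) <|
      all fun e => imp (!beq e m && !beq e p) <| tableCheck (symmTable a b c d e f)) = true := by
  decide +kernel

theorem tableCheck_symmTable (a b c d e f : Slot)
    (h : acyclicCheck (symmTable a b c d e f) = true) :
    tableCheck (symmTable a b c d e f) = true := by
  have key := all_tableCheck
  simp only [all_iff, imp_iff, Bool.and_eq_true] at key
  have h' := h
  simp only [acyclicCheck, all₃, Bool.and_eq_true, symmTable] at h'
  exact key a (by tauto) d (by tauto) f (by tauto) b (by tauto) c (by tauto) e (by tauto)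

/-- `occurs` searches only the block of `n`, `m`, `p`. All entries outside it are `zero`, hence the
restriction on `l`. -/
theorem occurs_iff {a b c d e f l : Slot} (hl : l ≠ zero) :
    occurs (symmTable a b c d e f) l = true ↔ ∃ i j, symmTable a b c d e f i j = l := by
  constructor
  · intro h
    obtain ⟨i, hi⟩ := exists_of_ex₃ h
    obtain ⟨j, hj⟩ := exists_of_ex₃ hi
    exact ⟨i, j, (beq_iff _ _).mp hj⟩
  · rintro ⟨i, j, h⟩
    simp only [occurs, ex₃, Bool.or_eq_true, beq_iff]
    cases i <;> cases j <;> simp only [symmTable] at h ⊢ <;> tauto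

end Slot

/-! ### Summands of the radical and their independence -/

/-- A decomposition of the radical as in `IsSimpleDecomposition`, with the last summand the centre
of the radical, such that nonzero brackets of summands are summands. -/
structure IsTabledDecomposition {g : Type*} [LieRing g] [LieAlgebra ℂ g]
    (gL : LieSubalgebra ℂ g) (V : Fin 4 → LieSubmodule ℂ gL g) : Prop
    extends IsSimpleDecomposition gL V where
  center_eq : centerOfIdeal (LieAlgebra.radical ℂ g) = (V 3).toSubmodule
  bracket_eq : ∀ i j, bracketSpan (V i).toSubmodule (V j).toSubmodule ≠ ⊥ →
    ∃ l, bracketSpan (V i).toSubmodule (V j).toSubmodule = (V l).toSubmodule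

section Decomposition

open Slot

variable {g : Type*} [LieRing g] [LieAlgebra ℂ g]

theorem mem_centerOfIdeal {h : LieIdeal ℂ g} {v : g} :
    v ∈ centerOfIdeal h ↔ v ∈ h ∧ ∀ w ∈ h, ⁅v, w⁆ = 0 := by
  constructor
  · rintro ⟨c, hc, rfl⟩
    refine ⟨c.2, fun w hw => ?_⟩
    have := congrArg Subtype.val ((LieModule.mem_maxTrivSubmodule ℂ h h c).mp hc ⟨w, hw⟩)
    rw [← lie_skew]
    exact neg_eq_zero.mpr this
  · rintro ⟨hv, h0⟩
    refine ⟨⟨v, hv⟩, (LieModule.mem_maxTrivSubmodule ℂ h h _).mpr fun w => ?_, rfl⟩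
    apply Subtype.ext
    change ⁅(w : g), v⁆ = 0
    rw [← lie_skew, h0 w w.2, neg_zero]

variable {gL : LieSubalgebra ℂ g}

/-- The subspace with a given index. -/
def Slot.val (V : Fin 4 → LieSubmodule ℂ gL g) : Slot → Submodule ℂ g
  | n => (V 0).toSubmodule
  | m => (V 1).toSubmodule
  | p => (V 2).toSubmodule
  | k => (V 3).toSubmodule
  | zero => ⊥

theorem exists_val_eq (V : Fin 4 → LieSubmodule ℂ gL g) (i : Fin 4) :
    ∃ x, val V x = (V i).toSubmodule := by
  fin_cases i
  exacts [⟨n, rfl⟩, ⟨m, rfl⟩, ⟨p, rfl⟩, ⟨k, rfl⟩]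

theorem val_eq_bot_or_exists (V : Fin 4 → LieSubmodule ℂ gL g) (x : Slot) :
    val V x = ⊥ ∨ ∃ i, val V x = (V i).toSubmodule := by
  cases x
  exacts [.inr ⟨0, rfl⟩, .inr ⟨1, rfl⟩, .inr ⟨2, rfl⟩, .inr ⟨3, rfl⟩, .inl rfl]

namespace IsSimpleDecomposition

variable {V : Fin 4 → LieSubmodule ℂ gL g} (hV : IsSimpleDecomposition gL V)
include hV

theorem iSup_val : ⨆ x, val V x = (LieAlgebra.radical ℂ g).toSubmodule := by
  rw [← hV.iSup_eq]
  refine le_antisymm (iSup_le fun x => ?_) (iSup_le fun i => ?_)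
  · obtain h | ⟨i, h⟩ := val_eq_bot_or_exists V x
    · rw [h]; exact bot_le
    · rw [h]; exact le_iSup (fun i => (V i).toSubmodule) i
  · obtain ⟨x, h⟩ := exists_val_eq V i
    rw [← h]
    exact le_iSup _ x

theorem val_le_radical (x : Slot) : val V x ≤ (LieAlgebra.radical ℂ g).toSubmodule :=
  hV.iSup_val ▸ le_iSup (val V) x

theorem toSubmodule_ne_bot (i : Fin 4) : (V i).toSubmodule ≠ ⊥ := by
  have := hV.isIrreducible i
  have := LieModule.nontrivial_of_isIrreducible ℂ gL (V i)
  rw [Ne, LieSubmodule.toSubmodule_eq_bot]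
  exact (LieSubmodule.nontrivial_iff_ne_bot ℂ gL g).mp this

theorem val_ne_bot {x : Slot} (hx : x ≠ zero) : val V x ≠ ⊥ := by
  cases x
  exacts [hV.toSubmodule_ne_bot 0, hV.toSubmodule_ne_bot 1, hV.toSubmodule_ne_bot 2,
    hV.toSubmodule_ne_bot 3, absurd rfl hx]

/-- A nonzero summand that lies in a sum of summands is one of them. -/
theorem mem_of_val_le {x : Slot} (hx : x ≠ zero) {S : Set Slot}
    (h : val V x ≤ ⨆ y ∈ S, val V y) : x ∈ S := by
  by_contra hxS
  -- The summand would be disjoint from a space containing it, hence from itself.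
  refine hV.val_ne_bot hx (disjoint_self.mp (Disjoint.mono_right h ?_))
  have key (i : Fin 4) : Disjoint (V i).toSubmodule (⨆ j ∈ {j | j ≠ i}, (V j).toSubmodule) :=
    hV.independent.disjoint_biSup (by simp)
  have le (j i : Fin 4) (h : j ≠ i) :
      (V j).toSubmodule ≤ ⨆ j ∈ {j | j ≠ i}, (V j).toSubmodule :=
    le_biSup (fun j => (V j).toSubmodule) h
  cases x
  · refine (key 0).mono_right (iSup₂_le fun y hy => ?_)
    cases y
    exacts [absurd hy hxS, le 1 0 (by decide), le 2 0 (by decide), le 3 0 (by decide), bot_le]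
  · refine (key 1).mono_right (iSup₂_le fun y hy => ?_)
    cases y
    exacts [le 0 1 (by decide), absurd hy hxS, le 2 1 (by decide), le 3 1 (by decide), bot_le]
  · refine (key 2).mono_right (iSup₂_le fun y hy => ?_)
    cases y
    exacts [le 0 2 (by decide), le 1 2 (by decide), absurd hy hxS, le 3 2 (by decide), bot_le]
  · refine (key 3).mono_right (iSup₂_le fun y hy => ?_)
    cases y
    exacts [le 0 3 (by decide), le 1 3 (by decide), le 2 3 (by decide), absurd hy hxS, bot_le]
  · exact absurd rfl hx

theorem val_le_sup {x y z : Slot} (h : val V x ≤ val V y ⊔ val V z) :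
    x = zero ∨ x = y ∨ x = z := by
  by_cases hx : x = zero
  · exact .inl hx
  · refine .inr (hV.mem_of_val_le hx (S := {y, z}) ?_)
    rwa [iSup_pair]

/-- The derived algebra of the radical is spanned by the brackets of the summands. -/
theorem derived_eq_iSup :
    derivedOfIdeal (LieAlgebra.radical ℂ g) = ⨆ x, ⨆ y, bracketSpan (val V x) (val V y) := by
  rw [derivedOfIdeal_eq_bracketSpan, ← hV.iSup_val]
  simp only [bracketSpan_eq_map₂, Submodule.map₂_iSup_left, Submodule.map₂_iSup_right]
  exact iSup_comm

/-- A summand that commutes with all summands is central. -/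
theorem val_le_center {x : Slot} (h : ∀ y, bracketSpan (val V x) (val V y) = ⊥) :
    val V x ≤ centerOfIdeal (LieAlgebra.radical ℂ g) := by
  have h0 : bracketSpan (val V x) (LieAlgebra.radical ℂ g).toSubmodule ≤ ⊥ := by
    rw [← hV.iSup_val, bracketSpan_eq_map₂, Submodule.map₂_iSup_right]
    exact iSup_le fun y => by rw [← bracketSpan_eq_map₂, h]
  intro v hv
  exact mem_centerOfIdeal.mpr ⟨hV.val_le_radical x hv, fun w hw =>
    (Submodule.mem_bot ℂ).mp (bracketSpan_le.mp h0 v hv w hw)⟩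

/-- A summand that is contained in its image under repeated brackets with summands vanishes. -/
theorem eq_zero_of_val_le [FiniteDimensional ℂ g] (hperf : IsPerfectLie g) {l i j h : Slot}
    (hl : val V l = bracketSpan (val V i) (val V l) ∨
      val V l = bracketSpan (val V j) (bracketSpan (val V i) (val V l)) ∨
      val V l = bracketSpan (val V h) (bracketSpan (val V j) (bracketSpan (val V i) (val V l)))) :
    l = zero := by
  by_contra hne
  refine hV.val_ne_bot hne (eq_bot_of_le_radical_lie_lieSpan hperf _ ?_)
  -- Bracketing with a summand sends `N` into the bracket of the radical with `N`, which lies in `N`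
  -- again; so every chain starting at `l` ends in that bracket.
  set N := LieSubmodule.lieSpan ℂ g (val V l : Set g)
  have step (i : Slot) {W : Submodule ℂ g} (hW : W ≤ N.toSubmodule) :
      bracketSpan (val V i) W ≤ (⁅LieAlgebra.radical ℂ g, N⁆ : LieIdeal ℂ g).toSubmodule :=
    bracketSpan_le_lie _ N (hV.val_le_radical i) hW
  have hle : (⁅LieAlgebra.radical ℂ g, N⁆ : LieIdeal ℂ g).toSubmodule ≤ N.toSubmodule :=
    LieSubmodule.lie_le_right N _
  have h0 : val V l ≤ N.toSubmodule := LieSubmodule.subset_lieSpan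
  have h1 := step i h0
  have h2 := step j (h1.trans hle)
  rcases hl with hl | hl | hl
  · exact hl.le.trans h1
  · exact hl.le.trans h2
  · exact hl.le.trans (step h (h2.trans hle))

end IsSimpleDecomposition

/-! ### The table of a decomposition and the conditions it satisfies -/

namespace IsTabledDecomposition

variable {V : Fin 4 → LieSubmodule ℂ gL g} (hV : IsTabledDecomposition gL V)
include hV

theorem bracketSpan_k (x : Slot) : bracketSpan (val V x) (val V k) = ⊥ := by
  rw [eq_bot_iff, bracketSpan_comm, bracketSpan_le]
  intro u hu w hw
  rw [val, ← hV.center_eq] at hu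
  exact (Submodule.mem_bot ℂ).mpr
    ((mem_centerOfIdeal.mp hu).2 w (hV.val_le_radical x hw))

theorem exists_bracketSpan_eq (i j : Fin 4) :
    ∃ x, bracketSpan (V i).toSubmodule (V j).toSubmodule = val V x := by
  by_cases h : bracketSpan (V i).toSubmodule (V j).toSubmodule = ⊥
  · exact ⟨zero, h⟩
  · obtain ⟨l, hl⟩ := hV.bracket_eq i j h
    obtain ⟨x, hx⟩ := exists_val_eq V l
    exact ⟨x, hl.trans hx.symm⟩

theorem exists_symmTable : ∃ a b c d e f, ∀ x y,
    bracketSpan (val V x) (val V y) = val V (symmTable a b c d e f x y) := by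
  obtain ⟨a, ha⟩ := hV.exists_bracketSpan_eq 0 0
  obtain ⟨b, hb⟩ := hV.exists_bracketSpan_eq 0 1
  obtain ⟨c, hc⟩ := hV.exists_bracketSpan_eq 0 2
  obtain ⟨d, hd⟩ := hV.exists_bracketSpan_eq 1 1
  obtain ⟨e, he⟩ := hV.exists_bracketSpan_eq 1 2
  obtain ⟨f, hf⟩ := hV.exists_bracketSpan_eq 2 2
  refine ⟨a, b, c, d, e, f, fun x y => ?_⟩
  have hk (x) : bracketSpan (val V x) (val V k) = ⊥ := hV.bracketSpan_k x
  have hk' (x) : bracketSpan (val V k) (val V x) = ⊥ := bracketSpan_comm _ _ |>.trans (hk x)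
  have hz (x) : bracketSpan (val V x) (val V zero) = ⊥ := bracketSpan_bot _
  have hz' (x) : bracketSpan (val V zero) (val V x) = ⊥ := bracketSpan_comm _ _ |>.trans (hz x)
  cases x
  · cases y
    exacts [ha, hb, hc, hk _, hz _]
  · cases y
    exacts [(bracketSpan_comm _ _).trans hb, hd, he, hk _, hz _]
  · cases y
    exacts [(bracketSpan_comm _ _).trans hc, (bracketSpan_comm _ _).trans he, hf, hk _, hz _]
  · cases y <;> exact hk' _
  · cases y <;> exact hz' _

variable {a b c d e f : Slot}
  (hT : ∀ x y, bracketSpan (val V x) (val V y) = val V (symmTable a b c d e f x y))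
include hT

/-- A zero row would make its summand central, hence contained in `V_k`, against independence. -/
theorem rowsCheck : rowsCheck (symmTable a b c d e f) = true := by
  refine all₃_of_forall fun i hik hi => ex₃_of_exists ?_ ?_ ?_
  · by_contra! h
    simp only [Bool.not_eq_true', Ne, beq_eq_false_iff, not_not] at h
    have := hV.val_le_center (x := i) fun y => by rw [hT, h, val]
    rw [hV.center_eq] at this
    have := hV.val_le_sup (x := i) (y := k) (z := k) (by rwa [sup_idem])
    tauto
  · simp [symmTable_k, beq]
  · simp [symmTable_zero, beq]

theorem jacobiCheck : jacobiCheck (symmTable a b c d e f) = true := by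
  refine all₃_of_forall fun i _ _ => all₃_of_forall fun j _ _ => all₃_of_forall fun l _ _ => ?_
  simp only [Bool.or_eq_true, beq_iff]
  apply hV.val_le_sup
  simp only [← hT]
  exact bracketSpan_jacobi _ _ _

/-- Length three suffices to exclude all cycles: row maps send `k` to `zero`, so a cycle runs
through `n`, `m`, `p` only. -/
theorem acyclicCheck [FiniteDimensional ℂ g] (hperf : IsPerfectLie g) :
    acyclicCheck (symmTable a b c d e f) = true := by
  refine all₃_of_forall fun l _ hl => all₃_of_forall fun i _ _ => ?_
  simp only [Bool.and_eq_true, Bool.not_eq_true', beq_eq_false_iff]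
  -- The first alternative involves only `i`; the values of `j` and `h` are dummies.
  refine ⟨fun h => hl (hV.eq_zero_of_val_le hperf (i := i) (j := i) (h := i) (.inl ?_)),
    all₃_of_forall fun j _ _ => ?_⟩
  · rw [hT, h]
  simp only [Bool.and_eq_true, Bool.not_eq_true', beq_eq_false_iff]
  refine ⟨fun h => hl (hV.eq_zero_of_val_le hperf (i := i) (j := j) (h := i) (.inr (.inl ?_))),
    all₃_of_forall fun h _ _ => ?_⟩
  · rw [hT, hT, h]
  simp only [Bool.not_eq_true', beq_eq_false_iff]
  intro h'
  refine hl (hV.eq_zero_of_val_le hperf (i := i) (j := j) (h := h) (.inr (.inr ?_)))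
  rw [hT, hT, hT, h']

theorem conclusionCheck [FiniteDimensional ℂ g] (hperf : IsPerfectLie g) :
    conclusionCheck (symmTable a b c d e f) = true := by
  have ha := hV.acyclicCheck hT hperf
  have := tableCheck_symmTable a b c d e f ha
  simp only [tableCheck, imp_iff] at this
  exact this ha (hV.rowsCheck hT) (hV.jacobiCheck hT)

theorem derived_eq : derivedOfIdeal (LieAlgebra.radical ℂ g) =
    ⨆ x ∈ {x | occurs (symmTable a b c d e f) x = true}, val V x := by
  rw [hV.derived_eq_iSup]
  refine le_antisymm (iSup_le fun x => iSup_le fun y => ?_) (iSup₂_le fun x hx => ?_)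
  · rw [hT]
    by_cases h : symmTable a b c d e f x y = zero
    · rw [h]; exact bot_le
    · exact le_biSup (val V) ((occurs_iff h).mpr ⟨x, y, rfl⟩)
  · by_cases h : x = zero
    · rw [h]; exact bot_le
    · obtain ⟨i, j, hij⟩ := (occurs_iff h).mp hx
      rw [← hij, ← hT]
      exact le_iSup₂ (f := fun x y => bracketSpan (val V x) (val V y)) i j

/-- By independence a sum of summands determines its nonzero indices, so the shape of the derived
algebra fixes which indices occur. -/
theorem occurs_iff_of_derived_eq {S : Set Slot}
    (hS : derivedOfIdeal (LieAlgebra.radical ℂ g) = ⨆ x ∈ S, val V x) {x : Slot} (hx : x ≠ zero) :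
    occurs (symmTable a b c d e f) x = true ↔ x ∈ S := by
  rw [hV.derived_eq hT] at hS
  exact ⟨fun h => hV.mem_of_val_le hx (hS ▸ le_biSup (val V) h),
    fun h => hV.mem_of_val_le hx (S := {x | occurs (symmTable a b c d e f) x = true})
      (hS ▸ le_biSup (val V) h)⟩

omit hV in
/-- The table conditions for the indices of `W 0, W 1, W 2` give a table for `W`. -/
theorem hasTableMPK {W : Fin 4 → LieSubmodule ℂ gL g} {i j l : Slot}
    (h0 : (W 0).toSubmodule = val V i) (h1 : (W 1).toSubmodule = val V j)
    (h2 : (W 2).toSubmodule = val V l) (h3 : (W 3).toSubmodule = val V k)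
    (h : fitsMPK (symmTable a b c d e f) i j l = true) : HasTable W tableMPK := by
  have hz : val V zero = ⊥ := rfl
  simp only [fitsMPK, Bool.and_eq_true, Bool.or_eq_true, beq_iff] at h
  intro x y
  fin_cases x <;> fin_cases y <;>
    simp [tableMPK, h0, h1, h2, h3, hT, symmTable_k, symmTable_comm _ _ _ _ _ _ k, h, hz,
      symmTable_comm _ _ _ _ _ _ j i, symmTable_comm _ _ _ _ _ _ l i,
      symmTable_comm _ _ _ _ _ _ l j]
  -- The only entry with a choice is the bracket of the second summand with itself.
  obtain h | h := h.2.2.2.1 <;> simp [h, hz]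

omit hV in
theorem hasTablePK {W : Fin 4 → LieSubmodule ℂ gL g} {i j l : Slot}
    (h0 : (W 0).toSubmodule = val V i) (h1 : (W 1).toSubmodule = val V j)
    (h2 : (W 2).toSubmodule = val V l) (h3 : (W 3).toSubmodule = val V k)
    (h : fitsPK (symmTable a b c d e f) i j l = true) : HasTablePK W := by
  have hz : val V zero = ⊥ := rfl
  simp only [fitsPK, Bool.or_eq_true] at h
  rcases h with h | h | h | h
  · refine .inl ?_
    simp only [fitsPK₁, Bool.and_eq_true, Bool.or_eq_true, beq_iff] at h
    intro x y
    fin_cases x <;> fin_cases y <;>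
      simp [tablePK₁, h0, h1, h2, h3, hT, symmTable_k, symmTable_comm _ _ _ _ _ _ k, h, hz,
        symmTable_comm _ _ _ _ _ _ j i, symmTable_comm _ _ _ _ _ _ l i,
        symmTable_comm _ _ _ _ _ _ l j]
    · obtain h | h | h := h.1 <;> simp [h, hz]
    · obtain h | h | h := h.2.2.2.1 <;> simp [h, hz]
  · refine .inr (.inl ?_)
    simp only [fitsPK₂, Bool.and_eq_true, Bool.or_eq_true, beq_iff] at h
    intro x y
    fin_cases x <;> fin_cases y <;>
      simp [tablePK₂, h0, h1, h2, h3, hT, symmTable_k, symmTable_comm _ _ _ _ _ _ k, h, hz,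
        symmTable_comm _ _ _ _ _ _ j i, symmTable_comm _ _ _ _ _ _ l i,
        symmTable_comm _ _ _ _ _ _ l j]
    · obtain h | h | h := h.1 <;> simp [h, hz]
    · obtain h | h := h.2.2.2.1 <;> simp [h, hz]
  · refine .inr (.inr (.inl ?_))
    simp only [fitsPK₃, Bool.and_eq_true, beq_iff] at h
    intro x y
    fin_cases x <;> fin_cases y <;>
      simp [tablePK₃, h0, h1, h2, h3, hT, symmTable_k, symmTable_comm _ _ _ _ _ _ k, h, hz,
        symmTable_comm _ _ _ _ _ _ j i, symmTable_comm _ _ _ _ _ _ l i,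
        symmTable_comm _ _ _ _ _ _ l j]
  · refine .inr (.inr (.inr ?_))
    simp only [fitsPK₄, Bool.and_eq_true, Bool.or_eq_true, beq_iff] at h
    intro x y
    fin_cases x <;> fin_cases y <;>
      simp [tablePK₄, h0, h1, h2, h3, hT, symmTable_k, symmTable_comm _ _ _ _ _ _ k, h, hz,
        symmTable_comm _ _ _ _ _ _ j i, symmTable_comm _ _ _ _ _ _ l i,
        symmTable_comm _ _ _ _ _ _ l j]
    · obtain h | h := h.2.2.2.1 <;> simp [h, hz]

theorem tableMPK_of_derived_eq [FiniteDimensional ℂ g] (hperf : IsPerfectLie g)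
    (hD : derivedOfIdeal (LieAlgebra.radical ℂ g) = (V 1 ⊔ V 2 ⊔ V 3).toSubmodule) :
    HasTable V tableMPK ∨ HasTable (V ∘ Equiv.swap 1 2) tableMPK := by
  have hS : derivedOfIdeal (LieAlgebra.radical ℂ g) = ⨆ x ∈ ({m, p, k} : Set Slot), val V x := by
    rw [hD, LieSubmodule.sup_toSubmodule, LieSubmodule.sup_toSubmodule, iSup_insert, iSup_pair,
      ← sup_assoc]
    rfl
  have hc := hV.conclusionCheck hT hperf
  simp only [Slot.conclusionCheck, Bool.and_eq_true, imp_iff, Bool.not_eq_true',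
    Bool.or_eq_true] at hc
  have hn : occurs (symmTable a b c d e f) n = false := by
    rw [← Bool.not_eq_true, hV.occurs_iff_of_derived_eq hT hS (x := n) nofun]; simp
  have hm : occurs (symmTable a b c d e f) m = true := by
    rw [hV.occurs_iff_of_derived_eq hT hS (x := m) nofun]; simp
  have hp : occurs (symmTable a b c d e f) p = true := by
    rw [hV.occurs_iff_of_derived_eq hT hS (x := p) nofun]; simp
  exact (hc.2.1 ⟨hn, hm, hp⟩).imp (hasTableMPK hT rfl rfl rfl rfl) (hasTableMPK hT rfl rfl rfl rfl)

theorem tablePK_of_derived_eq [FiniteDimensional ℂ g] (hperf : IsPerfectLie g)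
    (hD : derivedOfIdeal (LieAlgebra.radical ℂ g) = (V 2 ⊔ V 3).toSubmodule) :
    HasTablePK V ∨ HasTablePK (V ∘ Equiv.swap 0 1) := by
  have hS : derivedOfIdeal (LieAlgebra.radical ℂ g) = ⨆ x ∈ ({p, k} : Set Slot), val V x := by
    rw [hD, LieSubmodule.sup_toSubmodule, iSup_pair]
    rfl
  have hc := hV.conclusionCheck hT hperf
  simp only [Slot.conclusionCheck, Bool.and_eq_true, imp_iff, Bool.not_eq_true',
    Bool.or_eq_true] at hc
  have hn : occurs (symmTable a b c d e f) n = false := by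
    rw [← Bool.not_eq_true, hV.occurs_iff_of_derived_eq hT hS (x := n) nofun]; simp
  have hm : occurs (symmTable a b c d e f) m = false := by
    rw [← Bool.not_eq_true, hV.occurs_iff_of_derived_eq hT hS (x := m) nofun]; simp
  have hp : occurs (symmTable a b c d e f) p = true := by
    rw [hV.occurs_iff_of_derived_eq hT hS (x := p) nofun]; simp
  exact (hc.2.2 ⟨hn, hm, hp⟩).imp (hasTablePK hT rfl rfl rfl rfl) (hasTablePK hT rfl rfl rfl rfl)

omit hT in
/-- The radical has a derived algebra of one of three kinds. -/
theorem derived_cases [FiniteDimensional ℂ g] (hperf : IsPerfectLie g) :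
    derivedOfIdeal (LieAlgebra.radical ℂ g) = centerOfIdeal (LieAlgebra.radical ℂ g) ∨
    ∃ σ : Equiv.Perm (Fin 4), σ 3 = 3 ∧
      (derivedOfIdeal (LieAlgebra.radical ℂ g) = (V (σ 1) ⊔ V (σ 2) ⊔ V (σ 3)).toSubmodule ∨
        derivedOfIdeal (LieAlgebra.radical ℂ g) = (V (σ 2) ⊔ V (σ 3)).toSubmodule) := by
  obtain ⟨a, b, c, d, e, f, hT⟩ := hV.exists_symmTable
  have hc := hV.conclusionCheck hT hperf
  simp only [Slot.conclusionCheck, Bool.and_eq_true, Bool.not_eq_true'] at hc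
  have hk := hc.1.1
  have hnot := hc.1.2
  have hD : derivedOfIdeal (LieAlgebra.radical ℂ g) =
      (if occurs (symmTable a b c d e f) n = true then (V 0).toSubmodule else ⊥) ⊔
      (if occurs (symmTable a b c d e f) m = true then (V 1).toSubmodule else ⊥) ⊔
      (if occurs (symmTable a b c d e f) p = true then (V 2).toSubmodule else ⊥) ⊔
      (V 3).toSubmodule := by
    rw [hV.derived_eq hT]
    refine le_antisymm (iSup₂_le fun x hx => ?_) ?_
    · replace hx : occurs (symmTable a b c d e f) x = true := hx
      cases x <;> simp only [val, hx, if_true]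
      exacts [le_sup_of_le_left (le_sup_of_le_left le_sup_left),
        le_sup_of_le_left (le_sup_of_le_left le_sup_right), le_sup_of_le_left le_sup_right,
        le_sup_right, bot_le]
    · have le {x : Slot} (hx : occurs (symmTable a b c d e f) x = true) :
          val V x ≤ ⨆ x ∈ {x | occurs (symmTable a b c d e f) x = true}, val V x :=
        le_biSup (val V) hx
      refine sup_le (sup_le (sup_le ?_ ?_) ?_) (le hk) <;> split_ifs with h
      exacts [le h, bot_le, le h, bot_le, le h, bot_le]
  cases hn : occurs (symmTable a b c d e f) n <;> cases hm : occurs (symmTable a b c d e f) m <;>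
    cases hp : occurs (symmTable a b c d e f) p <;>
    simp only [hn, hm, hp, if_true, Bool.false_eq_true, if_false, bot_sup_eq, sup_bot_eq] at hD hnot
  -- In the cases below, `σ` moves the occurring indices to the last places before `3`. The final
  -- case, with all three occurring, is excluded by `hnot`.
  · exact .inl (hD.trans hV.center_eq.symm)
  · exact .inr ⟨1, rfl, .inr (hD.trans (LieSubmodule.sup_toSubmodule _ _).symm)⟩
  · exact .inr ⟨Equiv.swap 1 2, rfl, .inr (hD.trans (LieSubmodule.sup_toSubmodule _ _).symm)⟩
  · exact .inr ⟨1, rfl, .inl (hD.trans (by simp))⟩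
  · exact .inr ⟨Equiv.swap 0 2, rfl, .inr (hD.trans (LieSubmodule.sup_toSubmodule _ _).symm)⟩
  · exact .inr ⟨Equiv.swap 0 1, rfl, .inl (hD.trans (by simp [Equiv.swap_apply_of_ne_of_ne]))⟩
  · exact .inr ⟨Equiv.swap 0 2, rfl, .inl (hD.trans (by
      simp [Equiv.swap_apply_of_ne_of_ne, sup_comm]))⟩
  · simp at hnot

omit hT in
-- Lets the results for fixed names be applied after the relabelling from `derived_cases`.
theorem comp_perm {σ : Equiv.Perm (Fin 4)} (hσ : σ 3 = 3) : IsTabledDecomposition gL (V ∘ σ) where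
  isIrreducible i := hV.isIrreducible (σ i)
  independent := hV.independent.comp σ.injective
  iSup_eq := (Equiv.iSup_comp (g := fun i => (V i).toSubmodule) σ).trans hV.iSup_eq
  center_eq := by rw [Function.comp_apply, hσ, hV.center_eq]
  bracket_eq i j h := by
    obtain ⟨l, hl⟩ := hV.bracket_eq (σ i) (σ j) h
    exact ⟨σ.symm l, by simpa using hl⟩

end IsTabledDecomposition

end Decomposition

/-! ### The classification, up to relabelling -/

/-- Here `LieAlgebra.radical ℂ g` is `h`, and `V 0, V 1, V 2, V 3` are `V_n, V_m, V_p, V_k`. -/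
theorem mainTheorem7 {g : Type*} [LieRing g] [LieAlgebra ℂ g] [FiniteDimensional ℂ g]
    (hperf : IsPerfectLie g)
    (gL : LieSubalgebra ℂ g) (hgL : IsSimpleLevi gL)
    (V : Fin 4 → LieSubmodule ℂ gL g) (hV : IsSimpleDecomposition gL V)
    (hcenter : centerOfIdeal (LieAlgebra.radical ℂ g) = (V 3).toSubmodule)
    (hconv : ∀ i j, bracketSpan (V i).toSubmodule (V j).toSubmodule ≠ ⊥ →
      ∃ l, bracketSpan (V i).toSubmodule (V j).toSubmodule = (V l).toSubmodule) :
    -- after relabelling `V_n, V_m, V_p`, one of the three cases occurs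
    (derivedOfIdeal (LieAlgebra.radical ℂ g) = centerOfIdeal (LieAlgebra.radical ℂ g) ∨
      ∃ σ : Equiv.Perm (Fin 4), σ 3 = 3 ∧
        ((derivedOfIdeal (LieAlgebra.radical ℂ g) =
            (V (σ 1) ⊔ V (σ 2) ⊔ V (σ 3)).toSubmodule ∧ HasTable (V ∘ σ) tableMPK) ∨
          (derivedOfIdeal (LieAlgebra.radical ℂ g) = (V (σ 2) ⊔ V (σ 3)).toSubmodule ∧
            HasTablePK (V ∘ σ)))) ∧
    -- if `[h, h] = V_m ⊕ V_p ⊕ V_k`, only `V_m` and `V_p` may have to be exchanged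
    (derivedOfIdeal (LieAlgebra.radical ℂ g) = (V 1 ⊔ V 2 ⊔ V 3).toSubmodule →
      HasTable V tableMPK ∨ HasTable (V ∘ Equiv.swap 1 2) tableMPK) ∧
    -- if `[h, h] = V_p ⊕ V_k`, only `V_n` and `V_m` may have to be exchanged
    (derivedOfIdeal (LieAlgebra.radical ℂ g) = (V 2 ⊔ V 3).toSubmodule →
      HasTablePK V ∨ HasTablePK (V ∘ Equiv.swap 0 1)) := by
  have hT : IsTabledDecomposition gL V := ⟨hV, hcenter, hconv⟩
  have hmpk {W : Fin 4 → LieSubmodule ℂ gL g} (hW : IsTabledDecomposition gL W)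
      (hD : derivedOfIdeal (LieAlgebra.radical ℂ g) = (W 1 ⊔ W 2 ⊔ W 3).toSubmodule) :
      HasTable W tableMPK ∨ HasTable (W ∘ Equiv.swap 1 2) tableMPK := by
    obtain ⟨a, b, c, d, e, f, h⟩ := hW.exists_symmTable
    exact hW.tableMPK_of_derived_eq h hperf hD
  have hpk {W : Fin 4 → LieSubmodule ℂ gL g} (hW : IsTabledDecomposition gL W)
      (hD : derivedOfIdeal (LieAlgebra.radical ℂ g) = (W 2 ⊔ W 3).toSubmodule) :
      HasTablePK W ∨ HasTablePK (W ∘ Equiv.swap 0 1) := by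
    obtain ⟨a, b, c, d, e, f, h⟩ := hW.exists_symmTable
    exact hW.tablePK_of_derived_eq h hperf hD
  refine ⟨(hT.derived_cases hperf).imp_right ?_, hmpk hT, hpk hT⟩
  rintro ⟨σ, hσ, hD | hD⟩
  · obtain h | h := hmpk (hT.comp_perm hσ) hD
    · exact ⟨σ, hσ, .inl ⟨hD, h⟩⟩
    -- The extra exchange is absorbed into the permutation; it leaves `3` fixed and only reorders
    -- the sum.
    · refine ⟨(Equiv.swap 1 2).trans σ, hσ, .inl ⟨hD.trans ?_, h⟩⟩
      change (V (σ 1) ⊔ V (σ 2) ⊔ V (σ 3)).toSubmodule = (V (σ 2) ⊔ V (σ 1) ⊔ V (σ 3)).toSubmodule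
      rw [sup_comm (V (σ 1))]
  · obtain h | h := hpk (hT.comp_perm hσ) hD
    · exact ⟨σ, hσ, .inr ⟨hD, h⟩⟩
    · exact ⟨(Equiv.swap 0 1).trans σ, hσ, .inr ⟨hD, h⟩⟩
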